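/- Let $M$ be a topological space; homology and cohomology are singular. For $w\in H^2(M;\mathbb{Z}_2)$ and $B\in H_2(M;\mathbb{Z})$ let $w(B)\in\mathbb{Z}_2$ denote the value of $w$ on the mod $2$ reduction of $B$, and for $\kappa\in H^1(M;\mathbb{Z}_2)$ let $\kappa^2=\kappa\cup\kappa\in H^2(M;\mathbb{Z}_2)$. Then $$\{w\in H^2(M;\mathbb{Z}_2) : w(B)=0 \ \ \forall\, B\in H_2(M;\mathbb{Z})\}\ \supset\ \{\kappa^2 : \kappa\in H^1(M;\mathbb{Z}_2)\}.$$ If $H_1(M;\mathbb{Z})$ is finitely generated, then the reverse inclusion $$\{w\in H^2(M;\mathbb{Z}_2) : w(B)=0 \ \ \forall\, B\in H_2(M;\mathbb{Z})\}\ \subset\ \{\kappa^2 : \kappa\in H^1(M;\mathbb{Z}_2)\}$$ holds if and only if $H_1(M;\mathbb{Z})$ has no $4$-torsion, i.e. contains no element of order exactly $4$. -/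

import Mathlib

universe u

noncomputable section

namespace SingularCohomology

open CategoryTheory

/-! ### Cochains of a simplicial set with coefficients in a commutative ring -/

section Cochains

/-- The set of `n`-simplices of a simplicial set. -/
abbrev Simplex (X : SSet.{u}) (n : ℕ) : Type u := X.obj (Opposite.op (SimplexCategory.mk n))

variable (X : SSet.{u}) (R : Type) [CommRing R]

/-- `n`-cochains of `X` with coefficients in `R`: functions on the set of `n`-simplices. -/
abbrev Cochain (n : ℕ) : Type u := Simplex X n → R

/-- The coboundary operator, `(d φ)(σ) = ∑ i, (-1)^i φ(∂_i σ)`. -/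
def coboundary (n : ℕ) : Cochain X R n →ₗ[R] Cochain X R (n + 1) where
  toFun φ σ := ∑ i : Fin (n + 2), (-1 : R) ^ i.val * φ (X.δ i σ)
  map_add' φ ψ := by
    funext σ
    simp [mul_add, Finset.sum_add_distrib]
  map_smul' r φ := by
    funext σ
    simp only [Pi.smul_apply, smul_eq_mul, RingHom.id_apply, Finset.mul_sum]
    exact Finset.sum_congr rfl fun i _ => by ring

/-- The module of `n`-cocycles. -/
def cocycles (n : ℕ) : Submodule R (Cochain X R n) := LinearMap.ker (coboundary X R n)

/-- The module of `n`-coboundaries; in degree `0` it is trivial. -/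
def coboundaries : (n : ℕ) → Submodule R (Cochain X R n)
  | 0 => ⊥
  | n + 1 => LinearMap.range (coboundary X R n)

/-- The `n`-th cohomology of `X` with coefficients in `R`: cocycles modulo coboundaries. -/
abbrev Cohomology (n : ℕ) : Type u :=
  cocycles X R n ⧸ (coboundaries X R n).submoduleOf (cocycles X R n)

variable {X R}

lemma coboundary_zero_apply (f : Cochain X R 0) (σ : Simplex X 1) :
    coboundary X R 0 f σ = f (X.δ 0 σ) - f (X.δ 1 σ) := by
  simp [coboundary, Fin.sum_univ_succ]
  ring

lemma coboundary_one_apply (φ : Cochain X R 1) (σ : Simplex X 2) :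
    coboundary X R 1 φ σ = φ (X.δ 0 σ) - φ (X.δ 1 σ) + φ (X.δ 2 σ) := by
  simp [coboundary, Fin.sum_univ_succ]
  ring

lemma coboundary_two_apply (φ : Cochain X R 2) (σ : Simplex X 3) :
    coboundary X R 2 φ σ =
      φ (X.δ 0 σ) - φ (X.δ 1 σ) + φ (X.δ 2 σ) - φ (X.δ 3 σ) := by
  simp [coboundary, Fin.sum_univ_succ]
  ring

/-- The simplicial identity `∂_i ∂_{j+1} = ∂_j ∂_i` for `i ≤ j`, on elements. -/
lemma face_face {n : ℕ} {i j : Fin (n + 2)} (h : i ≤ j) (σ : Simplex X (n + 2)) :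
    X.δ i (X.δ j.succ σ) = X.δ j (X.δ i.castSucc σ) :=
  ConcreteCategory.congr_hom (X.δ_comp_δ h) σ

/-- The cup product of two `1`-cochains: on a `2`-simplex `σ = [v₀, v₁, v₂]` its value is
`φ [v₀, v₁] * ψ [v₁, v₂]`, where `[v₀, v₁] = ∂₂ σ` and `[v₁, v₂] = ∂₀ σ`. -/
def cupCochain (φ ψ : Cochain X R 1) : Cochain X R 2 :=
  fun σ => φ (X.δ 2 σ) * ψ (X.δ 0 σ)

lemma cupCochain_mem_cocycles {φ ψ : Cochain X R 1}
    (hφ : φ ∈ cocycles X R 1) (hψ : ψ ∈ cocycles X R 1) :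
    cupCochain φ ψ ∈ cocycles X R 2 := by
  rw [cocycles, LinearMap.mem_ker] at *
  funext σ
  have h1 := congrFun hφ (X.δ 3 σ)
  have h2 := congrFun hψ (X.δ 0 σ)
  rw [coboundary_one_apply, Pi.zero_apply] at h1 h2
  rw [coboundary_two_apply, Pi.zero_apply]
  simp only [cupCochain]
  have e01 : X.δ 0 (X.δ 1 σ) = X.δ 0 (X.δ 0 σ) :=
    face_face (i := 0) (j := 0) (by decide) σ
  have e02 : X.δ 0 (X.δ 2 σ) = X.δ 1 (X.δ 0 σ) :=
    face_face (i := 0) (j := 1) (by decide) σ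
  have e03 : X.δ 0 (X.δ 3 σ) = X.δ 2 (X.δ 0 σ) :=
    face_face (i := 0) (j := 2) (by decide) σ
  have e13 : X.δ 1 (X.δ 3 σ) = X.δ 2 (X.δ 1 σ) :=
    face_face (i := 1) (j := 2) (by decide) σ
  have e23 : X.δ 2 (X.δ 3 σ) = X.δ 2 (X.δ 2 σ) :=
    face_face (i := 2) (j := 2) (by decide) σ
  rw [e03, e13, e23] at h1
  rw [e01, e02, e23, e03]
  linear_combination ψ (X.δ 0 (X.δ 0 σ)) * h1 - φ (X.δ 2 (X.δ 2 σ)) * h2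

lemma cupCochain_coboundary_left (f : Cochain X R 0) {ψ : Cochain X R 1}
    (hψ : ψ ∈ cocycles X R 1) :
    cupCochain (coboundary X R 0 f) ψ ∈ coboundaries X R 2 := by
  rw [cocycles, LinearMap.mem_ker] at hψ
  refine ⟨fun σ => f (X.δ 1 σ) * ψ σ, ?_⟩
  funext σ
  have h := congrFun hψ σ
  rw [coboundary_one_apply, Pi.zero_apply] at h
  simp only [cupCochain, coboundary_one_apply, coboundary_zero_apply]
  have e02 : X.δ 0 (X.δ 2 σ) = X.δ 1 (X.δ 0 σ) :=
    face_face (i := 0) (j := 1) (by decide) σ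
  have e12 : X.δ 1 (X.δ 2 σ) = X.δ 1 (X.δ 1 σ) :=
    face_face (i := 1) (j := 1) (by decide) σ
  rw [e02, e12]
  linear_combination f (X.δ 1 (X.δ 1 σ)) * h

lemma cupCochain_coboundary_right (f : Cochain X R 0) {φ : Cochain X R 1}
    (hφ : φ ∈ cocycles X R 1) :
    cupCochain φ (coboundary X R 0 f) ∈ coboundaries X R 2 := by
  rw [cocycles, LinearMap.mem_ker] at hφ
  refine ⟨fun σ => - (φ σ * f (X.δ 0 σ)), ?_⟩
  funext σ
  have h := congrFun hφ σ
  rw [coboundary_one_apply, Pi.zero_apply] at h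
  simp only [cupCochain, coboundary_one_apply, coboundary_zero_apply]
  have e01 : X.δ 0 (X.δ 1 σ) = X.δ 0 (X.δ 0 σ) :=
    face_face (i := 0) (j := 0) (by decide) σ
  have e02 : X.δ 0 (X.δ 2 σ) = X.δ 1 (X.δ 0 σ) :=
    face_face (i := 0) (j := 1) (by decide) σ
  rw [e01, e02]
  linear_combination (- f (X.δ 0 (X.δ 0 σ))) * h

/-- The cup product `H¹(X; R) × H¹(X; R) → H²(X; R)`. -/
def cup : Cohomology X R 1 → Cohomology X R 1 → Cohomology X R 2 :=
  Quotient.map₂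
    (fun φ ψ => ⟨cupCochain φ.1 ψ.1, cupCochain_mem_cocycles φ.2 ψ.2⟩) (by
      intro φ φ' hφ ψ ψ' hψ
      obtain ⟨f, hf⟩ : φ.1 - φ'.1 ∈ coboundaries X R 1 :=
        (Submodule.quotientRel_def ((coboundaries X R 1).submoduleOf (cocycles X R 1))).1 hφ
      obtain ⟨g, hg⟩ : ψ.1 - ψ'.1 ∈ coboundaries X R 1 :=
        (Submodule.quotientRel_def ((coboundaries X R 1).submoduleOf (cocycles X R 1))).1 hψ
      refine (Submodule.quotientRel_def _).2 ?_
      have h : cupCochain φ.1 ψ.1 - cupCochain φ'.1 ψ'.1 =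
          cupCochain (coboundary X R 0 f) ψ.1 + cupCochain φ'.1 (coboundary X R 0 g) := by
        rw [hf, hg]
        funext σ
        simp only [cupCochain, Pi.sub_apply, Pi.add_apply]
        ring
      change cupCochain φ.1 ψ.1 - cupCochain φ'.1 ψ'.1 ∈ coboundaries X R 2
      rw [h]
      exact add_mem (cupCochain_coboundary_left f ψ.2) (cupCochain_coboundary_right g φ'.2))

end Cochains

/-! ### The pairing of cohomology with integral homology -/

section Pairing

/-- The coefficient group `ℤ`, in the universe of the space. -/
abbrev intCoeff : ModuleCat.{u} ℤ := ModuleCat.of ℤ (ULift.{u} ℤ)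

variable {X : SSet.{u}} {R : Type} [CommRing R]

/-- The extension of an `n`-cochain `φ` to a homomorphism from the integral `n`-chains to `R`:
on the summand `ℤ` of a simplex `σ` it is `k ↦ k • φ σ`. -/
def evalChain {n : ℕ} (φ : Cochain X R n) :
    (X.chainComplex intCoeff.{u}).X n ⟶ ModuleCat.of ℤ (ULift.{u} R) :=
  Limits.Cofan.IsColimit.desc (X.isColimitChainComplexXCofan intCoeff.{u} n) fun σ =>
    ModuleCat.ofHom ((LinearMap.toSpanSingleton ℤ (ULift.{u} R) (ULift.up (φ σ))).comp
      (ULift.moduleEquiv : ULift.{u} ℤ ≃ₗ[ℤ] ℤ).toLinearMap)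

@[simp]
lemma ι_evalChain {n : ℕ} (φ : Cochain X R n) (σ : Simplex X n) :
    X.ιChainComplex (R := intCoeff.{u}) σ ≫ evalChain φ =
      ModuleCat.ofHom ((LinearMap.toSpanSingleton ℤ (ULift.{u} R) (ULift.up (φ σ))).comp
        (ULift.moduleEquiv : ULift.{u} ℤ ≃ₗ[ℤ] ℤ).toLinearMap) :=
  Limits.Cofan.IsColimit.fac (X.isColimitChainComplexXCofan intCoeff.{u} n) _ σ

lemma evalChain_sub {n : ℕ} (φ ψ : Cochain X R n) :
    evalChain (φ - ψ) = evalChain φ - evalChain ψ := by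
  refine SSet.chainComplex_hom_ext fun σ => ?_
  rw [Preadditive.comp_sub, ι_evalChain, ι_evalChain, ι_evalChain]
  ext
  simp [mul_sub]

lemma d_evalChain {n : ℕ} (φ : Cochain X R n) :
    (X.chainComplex intCoeff.{u}).d (n + 1) n ≫ evalChain φ =
      evalChain (coboundary X R n φ) := by
  refine SSet.chainComplex_hom_ext fun σ => ?_
  rw [SSet.ιChainComplex_d_assoc, Preadditive.sum_comp]
  simp only [Preadditive.zsmul_comp, ι_evalChain]
  ext
  simp only [coboundary, ModuleCat.hom_sum, ModuleCat.hom_zsmul, ModuleCat.hom_ofHom,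
    LinearMap.sum_apply, LinearMap.smul_apply, LinearMap.comp_apply, LinearMap.toSpanSingleton_apply,
    LinearMap.coe_mk, AddHom.coe_mk]
  have h := fun f : Fin (n + 2) → ULift.{u} R =>
    map_sum (ULift.ringEquiv : ULift.{u} R ≃+* R) f Finset.univ
  refine (h _).trans ?_
  simp [Finset.mul_sum, mul_left_comm]
  rfl

lemma d_evalChain_eq_zero {n : ℕ} (φ : cocycles X R n) :
    (X.chainComplex intCoeff.{u}).d (n + 1) n ≫ evalChain φ.1 = 0 := by
  rw [d_evalChain, LinearMap.mem_ker.1 φ.2, ← sub_self (0 : Cochain X R (n + 1)),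
    evalChain_sub, sub_self]

/-- The homomorphism `H_n(X; ℤ) → R` given by an `n`-cocycle. -/
def evalHomology {n : ℕ} (φ : cocycles X R n) :
    X.homology intCoeff.{u} n ⟶ ModuleCat.of ℤ (ULift.{u} R) :=
  (X.chainComplex intCoeff.{u}).homologyι n ≫
    (X.chainComplex intCoeff.{u}).descOpcycles (evalChain φ.1) (n + 1) (by simp)
      (d_evalChain_eq_zero φ)

lemma evalHomology_congr {n : ℕ} (φ ψ : cocycles X R n)
    (h : φ.1 - ψ.1 ∈ coboundaries X R n) : evalHomology φ = evalHomology ψ := by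
  rw [← sub_eq_zero, evalHomology, evalHomology, ← Preadditive.comp_sub]
  cases n with
  | zero =>
    have h' : φ = ψ := Subtype.ext (sub_eq_zero.1 ((Submodule.mem_bot R).1 h))
    subst h'
    simp
  | succ n =>
    obtain ⟨f, hf⟩ := h
    rw [← (X.chainComplex intCoeff.{u}).homologyι_descOpcycles_eq_zero_of_boundary
      (evalChain (φ.1 - ψ.1)) (n + 2) (by simp) (evalChain f) (by rw [d_evalChain, hf])]
    congr 1
    rw [← cancel_epi ((X.chainComplex intCoeff.{u}).pOpcycles (n + 1)), Preadditive.comp_sub]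
    simp [evalChain_sub]

/-- The evaluation `w(B)` of `w ∈ Hⁿ(X; R)` on an integral class `B ∈ H_n(X; ℤ)`. -/
def pairing {n : ℕ} (w : Cohomology X R n) (B : (X.homology intCoeff.{u} n : ModuleCat.{u} ℤ)) : R :=
  Quotient.liftOn w (fun φ => ((evalHomology φ).hom B).down) fun φ ψ h => by
    rw [evalHomology_congr φ ψ ((Submodule.quotientRel_def
      ((coboundaries X R n).submoduleOf (cocycles X R n))).1 h)]

end Pairing

/-! ### Singular homology and cohomology of a topological space -/

section Singular

variable (M : Type u) [TopologicalSpace M]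

/-- `H_n(M; ℤ)`, Mathlib's singular homology. -/
abbrev singularHomology (n : ℕ) : ModuleCat.{u} ℤ :=
  ((AlgebraicTopology.singularHomologyFunctor (ModuleCat.{u} ℤ) n).obj intCoeff.{u}).obj
    (TopCat.of M)

/-- `Hⁿ(M; ℤ₂)`, the singular cohomology: the cohomology of the singular simplicial set of `M`. -/
abbrev singularCohomology (n : ℕ) : Type u :=
  Cohomology (TopCat.toSSet.obj (TopCat.of M)) (ZMod 2) n

variable {M}

/-- The value `w(B) ∈ ℤ₂` of `w ∈ Hⁿ(M; ℤ₂)` on `B ∈ H_n(M; ℤ)`. -/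
def evalOn {n : ℕ} (w : singularCohomology M n) (B : singularHomology M n) : ZMod 2 :=
  pairing (X := TopCat.toSSet.obj (TopCat.of M)) w B

end Singular

end SingularCohomology

end

/-!
The squares `κ²` are the values of the Bockstein homomorphism `H¹(X; ℤ/2) → H²(X; ℤ/2)` of
`ℤ/2 → ℤ/4 → ℤ/2`. More generally let `p` be a prime and `w` a cocycle of degree `n + 1` with
values in `ℤ/p`. Its class is a value of the Bockstein homomorphism of `ℤ/p → ℤ/p² → ℤ/p` iff
`p w : C_{n+1} → ℤ/p²` factors through the boundary operator `∂ : C_{n+1} → C_n`, which forces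
`w` to vanish on integral cycles. Since `ℤ/p²` is self-injective, `p w` factors through `∂` iff
`w a = 0` whenever `∂ a = p² b`.

If `w` vanishes on cycles and `C_n / ∂ C_{n+1}` has no element of order `p²`, then `∂ a = p² b`
gives `p b = ∂ c` for some `c`, so `a - p c` is a cycle and `w a = 0`. If conversely `b` has order
`p²` modulo boundaries, write `p² b = ∂ a`; then `∂ a` is not divisible by `p` in `∂ C_{n+1}`, so
some homomorphism `∂ C_{n+1} → ℤ/p` is nonzero at `∂ a`, and its composite with `∂` vanishes on
cycles but is not a value of the Bockstein homomorphism. Finally `C_n / ∂ C_{n+1}` and `H_n(X; ℤ)`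
have the same torsion, because the quotient of the former by the latter embeds in the torsion-free
group `C_{n-1}`.
-/

noncomputable section

namespace SingularCohomology

open CategoryTheory

section Algebra

/-- The inclusion of `ℤ/n` into `ℤ/n²` as the multiples of `n`, the first map of the coefficient
sequence `ℤ/n → ℤ/n² → ℤ/n` of the Bockstein homomorphism. -/
def zmodIncl (n : ℕ) : ZMod n →+ ZMod (n ^ 2) :=
  ZMod.lift n ⟨(AddMonoidHom.mulLeft (n : ZMod (n ^ 2))).comp (Int.castAddHom _), by
    simp [← sq, ← Nat.cast_pow]⟩

lemma zmodIncl_intCast (n : ℕ) (k : ℤ) : zmodIncl n k = n * k :=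
  ZMod.lift_coe n _ k

lemma zmodIncl_apply (n : ℕ) [NeZero n] (x : ZMod n) :
    zmodIncl n x = n * (x.val : ZMod (n ^ 2)) := by
  simpa using zmodIncl_intCast n x.val

lemma zmodIncl_injective (n : ℕ) [NeZero n] : Function.Injective (zmodIncl n) := by
  refine (ZMod.lift_injective n).2 fun k (hk : (n : ZMod (n ^ 2)) * k = 0) => ?_
  have h : ((n ^ 2 : ℕ) : ℤ) ∣ n * k := by
    rw [← ZMod.intCast_zmod_eq_zero_iff_dvd]
    exact_mod_cast hk
  rw [Nat.cast_pow, sq] at h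
  exact (ZMod.intCast_zmod_eq_zero_iff_dvd k n).2
    (Int.dvd_of_mul_dvd_mul_left (mod_cast NeZero.ne n) h)

lemma zmod_dvd_of_forall_mul_eq_zero {n : ℕ} [NeZero n] {a b : ZMod n}
    (h : ∀ r, r * a = 0 → r * b = 0) : a ∣ b := by
  obtain ⟨x, rfl⟩ := ZMod.intCast_surjective a
  obtain ⟨y, rfl⟩ := ZMod.intCast_surjective b
  set d : ℤ := ↑(x.gcd n) with hd
  obtain ⟨e, he⟩ : d ∣ n := Int.gcd_dvd_right ..
  obtain ⟨k, hk⟩ : d ∣ x := Int.gcd_dvd_left ..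
  have hn : (n : ℤ) ≠ 0 := mod_cast NeZero.ne n
  have he₀ : e ≠ 0 := right_ne_zero_of_mul (he ▸ hn)
  have hex : ((e : ZMod n)) * x = 0 := by
    rw [← Int.cast_mul, ZMod.intCast_zmod_eq_zero_iff_dvd]
    exact ⟨k, by rw [hk, he]; ring⟩
  have hdy : d ∣ y := by
    have hey := h e hex
    rw [← Int.cast_mul, ZMod.intCast_zmod_eq_zero_iff_dvd, he, mul_comm d] at hey
    exact Int.dvd_of_mul_dvd_mul_left he₀ hey
  have hxd : (x : ZMod n) ∣ (d : ZMod n) :=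
    ⟨x.gcdA n, by rw [hd, Int.gcd_eq_gcd_ab]; simp⟩
  exact hxd.trans (map_dvd (Int.castRingHom (ZMod n)) hdy)

lemma baer_zmod (n : ℕ) [NeZero n] : Module.Baer (ZMod n) (ZMod n) := by
  intro I g
  have : IsPrincipalIdealRing (ZMod n) :=
    IsPrincipalIdealRing.of_surjective (Int.castRingHom (ZMod n)) ZMod.intCast_surjective
  obtain ⟨a, rfl⟩ := (IsPrincipalIdealRing.principal I).principal
  let a' : Submodule.span (ZMod n) {a} := ⟨a, Submodule.mem_span_singleton_self a⟩
  obtain ⟨t, ht⟩ : a ∣ g a' := zmod_dvd_of_forall_mul_eq_zero fun r hr => by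
    rw [← smul_eq_mul, ← map_smul, show r • a' = 0 from Subtype.ext hr, map_zero]
  refine ⟨LinearMap.toSpanSingleton _ _ t, fun x hx => ?_⟩
  obtain ⟨r, rfl⟩ := Submodule.mem_span_singleton.1 hx
  calc (r • a) • t = r • g a' := by rw [ht, smul_assoc, smul_eq_mul a]
    _ = g ⟨r • a, hx⟩ := (map_smul g r a').symm

lemma exists_comp_eq_of_ker_le_ker {R M N Q : Type*} [Ring R] [AddCommGroup M] [AddCommGroup N]
    [AddCommGroup Q] [Module R M] [Module R N] [Module R Q] (hQ : Module.Baer R Q)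
    (f : M →ₗ[R] N) (g : M →ₗ[R] Q) (h : LinearMap.ker f ≤ LinearMap.ker g) :
    ∃ m : N →ₗ[R] Q, m.comp f = g := by
  obtain ⟨m, hm⟩ := hQ.extension_property ((LinearMap.ker f).liftQ f le_rfl)
    (LinearMap.ker_eq_bot.1 (Submodule.ker_liftQ_eq_bot _ _ _ le_rfl))
    ((LinearMap.ker f).liftQ g h)
  exact ⟨m, LinearMap.ext fun x => LinearMap.congr_fun hm ((LinearMap.ker f).mkQ x)⟩

variable {A B Q : Type*} [AddCommGroup A] [AddCommGroup B] [AddCommGroup Q]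

lemma modN_mkQ_eq_zero_iff {n : ℕ} {a : A} : ModN.mkQ n a = 0 ↔ ∃ b, n • b = a :=
  (Submodule.Quotient.mk_eq_zero _).trans (by simp)

lemma exists_zmod_hom_ne_zero {p : ℕ} [Fact p.Prime] {a : A} (ha : ¬ ∃ b, p • b = a) :
    ∃ W : A →+ ZMod p, W a ≠ 0 := by
  obtain ⟨g, hg⟩ := not_forall.1 <|
    mt (Module.forall_dual_apply_eq_zero_iff (ZMod p) _).1 (mt modN_mkQ_eq_zero_iff.1 ha)
  exact ⟨g.toAddMonoidHom.comp (ModN.mkQ p), hg⟩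

lemma exists_zmod_hom_comp_eq_iff {n : ℕ} [NeZero n] (f : A →+ B) (W : A →+ ZMod n) :
    (∃ m : B →+ ZMod n, m.comp f = W) ↔ ∀ a b, f a = n • b → W a = 0 := by
  constructor
  · rintro ⟨m, rfl⟩ a b h
    rw [AddMonoidHom.comp_apply, h, map_nsmul, nsmul_eq_mul, CharP.cast_eq_zero, zero_mul]
  intro hW
  let f' : ModN A n →ₗ[ZMod n] ModN B n := ModN.liftEquiv'.symm
    ⟨(ModN.mkQ n).comp f, fun a => by
      rw [AddMonoidHom.comp_apply, ← map_nsmul, modN_mkQ_eq_zero_iff]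
      exact ⟨f a, rfl⟩⟩
  let W' : ModN A n →ₗ[ZMod n] ZMod n := ModN.liftEquiv'.symm ⟨W, fun a => by simp⟩
  have hker : LinearMap.ker f' ≤ LinearMap.ker W' := by
    intro x hx
    obtain ⟨a, rfl⟩ := Submodule.mkQ_surjective _ x
    obtain ⟨b, hb⟩ := modN_mkQ_eq_zero_iff.1 (show ModN.mkQ n (f a) = 0 from hx)
    exact hW a b hb.symm
  obtain ⟨m, hm⟩ := exists_comp_eq_of_ker_le_ker (baer_zmod n) f' W' hker
  exact ⟨m.toAddMonoidHom.comp (ModN.mkQ n), AddMonoidHom.ext fun a =>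
    LinearMap.congr_fun hm (ModN.mkQ n a)⟩

lemma addOrderOf_eq_prime_sq_iff {p : ℕ} [hp : Fact p.Prime] {x : A} :
    addOrderOf x = p ^ 2 ↔ p ^ 2 • x = 0 ∧ p • x ≠ 0 := by
  constructor
  · intro h
    refine ⟨h ▸ addOrderOf_nsmul_eq_zero x, fun hpx => ?_⟩
    have := Nat.le_of_dvd hp.1.pos (h ▸ addOrderOf_dvd_of_nsmul_eq_zero hpx)
    exact absurd this (not_le.2 (lt_self_pow₀ hp.1.one_lt one_lt_two))
  · rintro ⟨h, hpx⟩
    exact addOrderOf_eq_prime_pow (n := 1) (by rwa [pow_one]) h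

variable {f : A →+ B} {g : B →+ Q} {p : ℕ} [Fact p.Prime]

lemma exists_comp_eq_zmodIncl_comp (hfg : Function.Exact f g)
    (hQ : ∀ x : Q, addOrderOf x ≠ p ^ 2) {W : A →+ ZMod p} (hW : f.ker ≤ W.ker) :
    ∃ m : B →+ ZMod (p ^ 2), m.comp f = (zmodIncl p).comp W := by
  refine (exists_zmod_hom_comp_eq_iff f _).2 fun a b hab => ?_
  have hgb : p ^ 2 • g b = 0 := by rw [← map_nsmul, ← hab, hfg.apply_apply_eq_zero]
  have hpb : p • g b = 0 := by
    by_contra h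
    exact hQ (g b) (addOrderOf_eq_prime_sq_iff.2 ⟨hgb, h⟩)
  obtain ⟨a', ha'⟩ := (hfg (p • b)).1 (by rw [map_nsmul, hpb])
  have hker : a - p • a' ∈ f.ker := by
    rw [AddMonoidHom.mem_ker, map_sub, map_nsmul, ha', hab, sq, mul_nsmul, sub_self]
  have hWa : W a = 0 := by simpa using hW hker
  rw [AddMonoidHom.comp_apply, hWa, map_zero]

lemma addOrderOf_ne_prime_sq_of_forall_exists_comp_eq [IsAddTorsionFree B]
    (hfg : Function.Exact f g) (hg : Function.Surjective g)
    (h : ∀ W : A →+ ZMod p, f.ker ≤ W.ker →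
      ∃ m : B →+ ZMod (p ^ 2), m.comp f = (zmodIncl p).comp W) (x : Q) :
    addOrderOf x ≠ p ^ 2 := by
  obtain ⟨b, rfl⟩ := hg x
  intro hb
  obtain ⟨hb₂, hb₁⟩ := addOrderOf_eq_prime_sq_iff.1 hb
  obtain ⟨a, ha⟩ := (hfg (p ^ 2 • b)).1 (by rw [map_nsmul, hb₂])
  obtain ⟨W, hW⟩ : ∃ W : f.range →+ ZMod p, W (f.rangeRestrict a) ≠ 0 := by
    refine exists_zmod_hom_ne_zero ?_
    rintro ⟨⟨_, a', rfl⟩, ha'⟩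
    have hpb : p • f a' = p • (p • b) := by
      rw [← mul_nsmul, ← sq, ← ha]
      exact congrArg Subtype.val ha'
    rw [nsmul_right_inj (NeZero.ne p)] at hpb
    exact hb₁ (by rw [← map_nsmul, ← hpb, hfg.apply_apply_eq_zero])
  have hker : f.ker ≤ (W.comp f.rangeRestrict).ker := by
    rw [← f.ker_rangeRestrict]
    exact fun a ha => (congrArg W ha).trans (map_zero W)
  have hWa := (exists_zmod_hom_comp_eq_iff f _).1 (h _ hker) a b ha
  exact hW (zmodIncl_injective p (hWa.trans (map_zero _).symm))

end Algebra

section Homology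

variable {S : Type*} [Ring S] {ι : Type*} {c : ComplexShape ι}
  (K : HomologicalComplex (ModuleCat.{u} S) c) {i j : ι}

lemma exact_d_pOpcycles (hij : c.prev j = i) : Function.Exact (K.d i j) (K.pOpcycles j) :=
  (ShortComplex.ShortExact.moduleCat_exact_iff_function_exact (.mk _ _ (K.d_pOpcycles i j))).1
    (ShortComplex.exact_of_g_is_cokernel _ (K.opcyclesIsCokernel i j hij))

lemma exact_iCycles_d (hij : c.next i = j) : Function.Exact (K.iCycles i) (K.d i j) :=
  (ShortComplex.ShortExact.moduleCat_exact_iff_function_exact (.mk _ _ (K.iCycles_d i j))).1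
    (ShortComplex.exact_of_f_is_kernel _ (K.cyclesIsKernel i j hij))

lemma exact_homologyι_fromOpcycles (hij : c.next i = j) :
    Function.Exact (K.homologyι i) (K.fromOpcycles i j) :=
  (ShortComplex.ShortExact.moduleCat_exact_iff_function_exact
    (.mk _ _ (K.homologyι_comp_fromOpcycles i j))).1
    (ShortComplex.exact_of_f_is_kernel _ (K.homologyIsKernel i j hij))

lemma addOrderOf_homologyι (x : K.homology i) :
    addOrderOf (K.homologyι i x) = addOrderOf x :=
  addOrderOf_injective (K.homologyι i).hom.toAddMonoidHom
    ((ModuleCat.mono_iff_injective _).1 inferInstance) x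

lemma forall_homology_addOrderOf_ne_iff (hij : c.next i = j) [IsAddTorsionFree (K.X j)] {n : ℕ}
    (hn : n ≠ 0) :
    (∀ x : K.homology i, addOrderOf x ≠ n) ↔ ∀ x : K.opcycles i, addOrderOf x ≠ n := by
  refine ⟨fun h x hx => ?_, fun h x => addOrderOf_homologyι K x ▸ h _⟩
  have hx₀ : K.fromOpcycles i j x = 0 := by
    rw [← nsmul_eq_zero_iff_right hn, ← map_nsmul, ← hx, addOrderOf_nsmul_eq_zero, map_zero]
  obtain ⟨y, rfl⟩ := (exact_homologyι_fromOpcycles K hij x).1 hx₀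
  exact h y (addOrderOf_homologyι K y ▸ hx)

end Homology

section Basis

variable (S : Type) [Ring S] (J : Type u)

/-- The cocone exhibiting the finitely supported functions `J →₀ S` as a coproduct of copies of
`S`, which are lifted to the universe of `J` to match the summands of the chain groups. -/
def finsuppCofan : Limits.Cofan fun _ : J => ModuleCat.of S (ULift.{u} S) :=
  Limits.Cofan.mk (ModuleCat.of S (J →₀ S)) fun j =>
    ModuleCat.ofHom ((Finsupp.lsingle j).comp ULift.moduleEquiv.toLinearMap)

variable {S} in
lemma ulift_hom_ext {V : ModuleCat.{u} S} {f g : ModuleCat.of S (ULift.{u} S) ⟶ V}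
    (h : f (ULift.up 1) = g (ULift.up 1)) : f = g := by
  ext k
  rw [show k = k.down • ULift.up 1 from ULift.ext _ _ (mul_one k.down).symm, map_smul, map_smul]
  exact congrArg (k.down • ·) h

/-- The universal property of the coproduct for `finsuppCofan`, which transports the standard basis
of `J →₀ S` to any other coproduct of copies of `S`. -/
def isColimitFinsuppCofan : Limits.IsColimit (finsuppCofan S J) :=
  Limits.Cofan.IsColimit.mk _
    (fun s => ModuleCat.ofHom (Finsupp.linearCombination S fun j => s.inj j (ULift.up 1)))
    (fun s j => ulift_hom_ext (by simp [finsuppCofan]))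
    (fun s m hm => ModuleCat.hom_ext <| Finsupp.lhom_ext' fun j => LinearMap.ext_ring <| by
      change m (Finsupp.single j 1) = Finsupp.linearCombination S _ (Finsupp.single j 1)
      rw [Finsupp.linearCombination_single, one_smul]
      exact ConcreteCategory.congr_hom (hm j) (ULift.up 1))

variable {S J} {c : Limits.Cofan fun _ : J => ModuleCat.of S (ULift.{u} S)}

/-- The canonical basis of a coproduct of copies of `S`, indexed by the set of summands. -/
def basisOfIsColimit (hc : Limits.IsColimit c) : Module.Basis J S c.pt :=
  .ofRepr (hc.coconePointUniqueUpToIso (isColimitFinsuppCofan S J)).toLinearEquiv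

lemma basisOfIsColimit_apply (hc : Limits.IsColimit c) (j : J) :
    basisOfIsColimit hc j = c.inj j (ULift.up 1) :=
  ConcreteCategory.congr_hom
    (hc.comp_coconePointUniqueUpToIso_inv (isColimitFinsuppCofan S J) ⟨j⟩) (ULift.up 1)

end Basis

section Chains

variable (X : SSet.{u}) (n : ℕ)

/-- The integral `n`-chains of `X`. -/
abbrev Chain : ModuleCat.{u} ℤ := (X.chainComplex intCoeff.{u}).X n

/-- The boundary operator on integral chains. -/
def boundary : Chain X (n + 1) →+ Chain X n :=
  ((X.chainComplex intCoeff.{u}).d (n + 1) n).hom.toAddMonoidHom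

/-- The basis of the integral chains formed by the simplices. -/
def chainBasis : Module.Basis (Simplex X n) ℤ (Chain X n) :=
  basisOfIsColimit (X.isColimitChainComplexXCofan intCoeff.{u} n)

lemma chainBasis_apply (σ : Simplex X n) :
    chainBasis X n σ = X.ιChainComplex (R := intCoeff.{u}) σ (ULift.up 1) :=
  basisOfIsColimit_apply _ σ

instance : IsAddTorsionFree (Chain X n) :=
  (chainBasis X n).repr.injective.isAddTorsionFree (chainBasis X n).repr.toAddMonoidHom

lemma boundary_comp_boundary : (boundary X n).comp (boundary X (n + 1)) = 0 :=
  AddMonoidHom.ext <| ConcreteCategory.congr_hom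
    ((X.chainComplex intCoeff.{u}).d_comp_d (n + 2) (n + 1) n)

variable {X n}

lemma chain_hom_ext {G : Type*} [AddCommGroup G] {f g : Chain X n →+ G}
    (h : ∀ σ, f (chainBasis X n σ) = g (chainBasis X n σ)) : f = g := by
  let e : (Simplex X n →₀ ℤ) ≃+ Chain X n := (chainBasis X n).repr.symm.toAddEquiv
  refine (AddMonoidHom.cancel_right e.surjective (f := (e : (Simplex X n →₀ ℤ) →+ Chain X n))).1 ?_
  exact Finsupp.addHom_ext' fun σ => AddMonoidHom.ext_int (h σ)

variable {R : Type} [CommRing R]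

/-- The identification of cochains with homomorphisms on the integral chains. -/
def chainHom : Cochain X R n ≃ (Chain X n →+ R) :=
  let ev (φ : Cochain X R n) : Chain X n →+ R :=
    AddEquiv.ulift.toAddMonoidHom.comp (evalChain φ).hom.toAddMonoidHom
  have ev_chainBasis (φ : Cochain X R n) (σ : Simplex X n) : ev φ (chainBasis X n σ) = φ σ := by
    rw [chainBasis_apply]
    have h := ConcreteCategory.congr_hom (ι_evalChain φ σ) (ULift.up 1)
    exact (congrArg ULift.down h).trans (by simp)
  { toFun := ev
    invFun := fun f σ => f (chainBasis X n σ)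
    left_inv := fun φ => funext (ev_chainBasis φ)
    right_inv := fun f => chain_hom_ext (ev_chainBasis _) }

lemma chainHom_chainBasis (φ : Cochain X R n) (σ : Simplex X n) :
    chainHom φ (chainBasis X n σ) = φ σ :=
  congrFun (chainHom.symm_apply_apply φ) σ

lemma chainHom_coboundary (φ : Cochain X R n) :
    chainHom (coboundary X R n φ) = (chainHom φ).comp (boundary X n) :=
  AddMonoidHom.ext fun c =>
    congrArg ULift.down (ConcreteCategory.congr_hom (d_evalChain φ) c).symm

lemma chainHom_comp {R' : Type} [CommRing R'] (g : R →+ R') (φ : Cochain X R n) :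
    chainHom (fun σ => g (φ σ)) = g.comp (chainHom φ) :=
  chain_hom_ext fun σ => by simp only [AddMonoidHom.comp_apply, chainHom_chainBasis]

lemma mem_cocycles_of_ker_boundary_le {φ : Cochain X R (n + 1)}
    (h : (boundary X n).ker ≤ (chainHom φ).ker) : φ ∈ cocycles X R (n + 1) := by
  refine LinearMap.mem_ker.2 (funext fun σ => ?_)
  rw [← chainHom_chainBasis (coboundary X R (n + 1) φ), chainHom_coboundary]
  exact h (DFunLike.congr_fun (boundary_comp_boundary X n) _)

lemma pairing_mk_homologyπ (φ : cocycles X R n) (z : (X.chainComplex intCoeff.{u}).cycles n) :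
    pairing (Submodule.Quotient.mk φ : Cohomology X R n)
        ((X.chainComplex intCoeff.{u}).homologyπ n z) =
      chainHom φ.1 ((X.chainComplex intCoeff.{u}).iCycles n z) := by
  have h : (X.chainComplex intCoeff.{u}).homologyπ n ≫ evalHomology φ =
      (X.chainComplex intCoeff.{u}).iCycles n ≫ evalChain φ.1 := by
    simp [evalHomology]
  exact congrArg ULift.down (ConcreteCategory.congr_hom h z)

lemma forall_pairing_eq_zero_iff (φ : cocycles X R (n + 1)) :
    (∀ B, pairing (Submodule.Quotient.mk φ : Cohomology X R (n + 1)) B = 0) ↔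
      (boundary X n).ker ≤ (chainHom φ.1).ker := by
  have hex := exact_iCycles_d (X.chainComplex intCoeff.{u}) (ChainComplex.next_nat_succ n)
  constructor
  · intro h c hc
    obtain ⟨z, rfl⟩ := (hex c).1 hc
    exact (pairing_mk_homologyπ φ z).symm.trans (h _)
  · intro h B
    obtain ⟨z, rfl⟩ := (ModuleCat.epi_iff_surjective
      ((X.chainComplex intCoeff.{u}).homologyπ (n + 1))).1 inferInstance B
    exact (pairing_mk_homologyπ φ z).trans (h (hex.apply_apply_eq_zero z))

end Chains

section Bockstein

variable {X : SSet.{u}} {k : ℕ}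

/-- A cochain `w` is a Bockstein cocycle if its class is in the image of the Bockstein homomorphism
`Hᵏ(X; ℤ/n) → Hᵏ⁺¹(X; ℤ/n)` of `ℤ/n → ℤ/n² → ℤ/n`. In terms of cochains this says that `n • w`,
with values in `ℤ/n²`, is a coboundary. -/
def IsBockstein {n : ℕ} (w : Cochain X (ZMod n) (k + 1)) : Prop :=
  ∃ μ : Cochain X (ZMod (n ^ 2)) k, coboundary X (ZMod (n ^ 2)) k μ = fun σ => zmodIncl n (w σ)

lemma isBockstein_iff_exists_comp_boundary_eq {n : ℕ} {w : Cochain X (ZMod n) (k + 1)} :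
    IsBockstein w ↔
      ∃ m : Chain X k →+ ZMod (n ^ 2), m.comp (boundary X k) = (zmodIncl n).comp (chainHom w) :=
  chainHom.exists_congr fun μ => by
    rw [← chainHom_coboundary, ← chainHom_comp, chainHom.apply_eq_iff_eq]

lemma IsBockstein.forall_pairing_eq_zero {n : ℕ} [NeZero n] {w : cocycles X (ZMod n) (k + 1)}
    (hw : IsBockstein w.1) (B : (X.homology intCoeff.{u} (k + 1) : ModuleCat.{u} ℤ)) :
    pairing (Submodule.Quotient.mk w : Cohomology X (ZMod n) (k + 1)) B = 0 := by
  obtain ⟨m, hm⟩ := isBockstein_iff_exists_comp_boundary_eq.1 hw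
  refine (forall_pairing_eq_zero_iff w).2 (fun c hc => zmodIncl_injective n ?_) B
  calc zmodIncl n (chainHom w.1 c) = m (boundary X k c) := (DFunLike.congr_fun hm c).symm
    _ = zmodIncl n 0 := by rw [show boundary X k c = 0 from hc, map_zero, map_zero]

theorem forall_isBockstein_iff_forall_addOrderOf_ne (p : ℕ) [hp : Fact p.Prime] :
    (∀ w : cocycles X (ZMod p) (k + 1),
        (∀ B, pairing (Submodule.Quotient.mk w : Cohomology X (ZMod p) (k + 1)) B = 0) →
          IsBockstein w.1) ↔
      ∀ x : (X.homology intCoeff.{u} k : ModuleCat.{u} ℤ), addOrderOf x ≠ p ^ 2 := by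
  let K := X.chainComplex intCoeff.{u}
  have hex : Function.Exact (boundary X k) (K.pOpcycles k).hom.toAddMonoidHom :=
    exact_d_pOpcycles K (ChainComplex.prev ℕ k)
  rw [forall_homology_addOrderOf_ne_iff K rfl (pow_ne_zero 2 hp.1.ne_zero)]
  constructor
  · intro h
    refine addOrderOf_ne_prime_sq_of_forall_exists_comp_eq hex
      ((ModuleCat.epi_iff_surjective (K.pOpcycles k)).1 inferInstance) fun W hW => ?_
    obtain ⟨w, rfl⟩ := chainHom.surjective W
    exact isBockstein_iff_exists_comp_boundary_eq.1 <|
      h ⟨w, mem_cocycles_of_ker_boundary_le hW⟩ ((forall_pairing_eq_zero_iff _).2 hW)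
  · exact fun h w hw => isBockstein_iff_exists_comp_boundary_eq.2 <|
      exists_comp_eq_zmodIncl_comp hex h ((forall_pairing_eq_zero_iff w).1 hw)

end Bockstein

section Squares

variable {X : SSet.{u}}

lemma zmodIncl_two_apply (x : ZMod 2) : zmodIncl 2 x = (2 * x.val : ZMod 4) :=
  zmodIncl_apply 2 x

/-- The Bockstein relation `d (κ̃ + 2 φ) = 2 (κ ∪ κ + d φ)` modulo `4`, where `κ̃` is the lift of
`κ` with values in `{0, 1}`. -/
lemma isBockstein_cupCochain_add_coboundary {κ : Cochain X (ZMod 2) 1}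
    (hκ : κ ∈ cocycles X (ZMod 2) 1) (φ : Cochain X (ZMod 2) 1) :
    IsBockstein (cupCochain κ κ + coboundary X (ZMod 2) 1 φ) := by
  refine ⟨fun σ => (κ σ).val + zmodIncl 2 (φ σ), funext fun σ => ?_⟩
  have h := congrFun (LinearMap.mem_ker.1 hκ) σ
  rw [coboundary_one_apply, Pi.zero_apply] at h
  rw [coboundary_one_apply, Pi.add_apply, coboundary_one_apply, map_add, map_add, map_sub]
  have key : ∀ a b c : ZMod 2, a - b + c = 0 →
      (a.val : ZMod 4) - b.val + c.val = 2 * (c * a).val := by decide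
  rw [cupCochain, zmodIncl_two_apply (κ _ * κ _)]
  linear_combination key _ _ _ h

lemma IsBockstein.exists_eq_cupCochain_add_coboundary {w : Cochain X (ZMod 2) 2}
    (h : IsBockstein w) :
    ∃ κ ∈ cocycles X (ZMod 2) 1, ∃ φ, w = cupCochain κ κ + coboundary X (ZMod 2) 1 φ := by
  obtain ⟨μ, hμ⟩ := h
  have key₁ : ∀ a b c : ZMod 4, ∀ w : ZMod 2, a - b + c = 2 * w.val →
      (a.val : ZMod 2) - b.val + c.val = 0 := by decide
  have key₂ : ∀ a b c : ZMod 4, ∀ w : ZMod 2, a - b + c = 2 * w.val →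
      w = (c.val : ZMod 2) * a.val +
        (((a.val / 2 : ℕ) : ZMod 2) - (b.val / 2 : ℕ) + (c.val / 2 : ℕ)) := by decide
  have hμ' : ∀ σ, μ (X.δ 0 σ) - μ (X.δ 1 σ) + μ (X.δ 2 σ) = (2 * (w σ).val : ZMod 4) := by
    intro σ
    rw [← coboundary_one_apply, ← zmodIncl_two_apply, hμ]
  -- `κ` and `φ` are the two binary digits of `μ`.
  refine ⟨fun σ => (μ σ).val, LinearMap.mem_ker.2 (funext fun σ => ?_),
    fun σ => ((μ σ).val / 2 : ℕ), funext fun σ => ?_⟩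
  · rw [coboundary_one_apply]
    exact key₁ _ _ _ _ (hμ' σ)
  · rw [Pi.add_apply, coboundary_one_apply]
    exact key₂ _ _ _ _ (hμ' σ)

lemma exists_mk_eq_cup_self_iff (w : cocycles X (ZMod 2) 2) :
    (∃ κ : Cohomology X (ZMod 2) 1,
      (Submodule.Quotient.mk w : Cohomology X (ZMod 2) 2) = cup κ κ) ↔ IsBockstein w.1 := by
  have mk_eq_cup_iff (κ : cocycles X (ZMod 2) 1) :
      (Submodule.Quotient.mk w : Cohomology X (ZMod 2) 2) =
          cup (Submodule.Quotient.mk κ) (Submodule.Quotient.mk κ) ↔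
        w.1 - cupCochain κ.1 κ.1 ∈ coboundaries X (ZMod 2) 2 :=
    Submodule.Quotient.eq ((coboundaries X (ZMod 2) 2).submoduleOf (cocycles X (ZMod 2) 2))
      (x := w) (y := ⟨_, cupCochain_mem_cocycles κ.2 κ.2⟩)
  constructor
  · rintro ⟨κ, hκ⟩
    obtain ⟨κ, rfl⟩ := Submodule.Quotient.mk_surjective _ κ
    obtain ⟨φ, hφ⟩ := (mk_eq_cup_iff κ).1 hκ
    rw [← add_sub_cancel (cupCochain κ.1 κ.1) w.1, ← hφ]
    exact isBockstein_cupCochain_add_coboundary κ.2 φ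
  · intro hw
    obtain ⟨κ, hκ, φ, hwφ⟩ := hw.exists_eq_cupCochain_add_coboundary
    exact ⟨_, (mk_eq_cup_iff ⟨κ, hκ⟩).2 ⟨φ, by rw [hwφ, add_sub_cancel_left]⟩⟩

end Squares

end SingularCohomology

end

open SingularCohomology in
theorem corollary2p3_general (X : SSet.{u}) :
    {w : Cohomology X (ZMod 2) 2 |
        ∀ B : (X.homology intCoeff.{u} 2 : ModuleCat.{u} ℤ), pairing w B = 0} ⊇
      {w | ∃ κ : Cohomology X (ZMod 2) 1, w = cup κ κ} ∧
    ({w : Cohomology X (ZMod 2) 2 |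
          ∀ B : (X.homology intCoeff.{u} 2 : ModuleCat.{u} ℤ), pairing w B = 0} ⊆
        {w | ∃ κ : Cohomology X (ZMod 2) 1, w = cup κ κ} ↔
      ∀ x : (X.homology intCoeff.{u} 1 : ModuleCat.{u} ℤ), addOrderOf x ≠ 4) := by
  constructor
  · rintro w hw
    obtain ⟨w, rfl⟩ := Submodule.Quotient.mk_surjective _ w
    exact ((exists_mk_eq_cup_self_iff w).1 hw).forall_pairing_eq_zero
  · refine Iff.trans ?_ (forall_isBockstein_iff_forall_addOrderOf_ne 2)
    simp only [← exists_mk_eq_cup_self_iff]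
    exact (Submodule.Quotient.mk_surjective _).forall

theorem corollary2p3 (M : Type u) [TopologicalSpace M] :
    {w : SingularCohomology.singularCohomology M 2 |
        ∀ B : SingularCohomology.singularHomology M 2, SingularCohomology.evalOn w B = 0} ⊇
      {w | ∃ κ : SingularCohomology.singularCohomology M 1, w = SingularCohomology.cup κ κ} ∧
    (Module.Finite ℤ (SingularCohomology.singularHomology M 1) →
      ({w : SingularCohomology.singularCohomology M 2 |
          ∀ B : SingularCohomology.singularHomology M 2, SingularCohomology.evalOn w B = 0} ⊆
        {w | ∃ κ : SingularCohomology.singularCohomology M 1, w = SingularCohomology.cup κ κ} ↔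
      ∀ x : SingularCohomology.singularHomology M 1, addOrderOf x ≠ 4)) :=
  have h := corollary2p3_general (TopCat.toSSet.obj (TopCat.of M))
  ⟨h.1, fun _ => h.2⟩
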